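/- Let $\mathcal G=(\mathcal V,\mathcal E)$ be a directed graph with $\mathcal V=\{1,\dots,n\}$ and $\mathcal E\subseteq\mathcal V\times\mathcal V$ (self-loops allowed), and let $\gamma_1,\dots,\gamma_n\in\mathbb R$, $\Gamma=\mathrm{diag}(\gamma_1,\dots,\gamma_n)$. For real edge weights $a_{ij}$, $(j,i)\in\mathcal E$, let $A\in\mathbb R^{n\times n}$ have entries $[A]_{ij}=a_{ij}$ if $(j,i)\in\mathcal E$ and $[A]_{ij}=0$ otherwise, and consider the network system $\dot x=(\Gamma+A)x+u$. Its complexity is $$\varphi=\delta_M\big((sI-\Gamma)(sI-\Gamma-A)^{-1}\big),$$ where the McMillan degree $\delta_M(G)$ of a real rational matrix $G(s)$ is the sum, over the distinct poles $p\in\mathbb C\cup\{\infty\}$ of the entries of $G$, of the largest multiplicity that $p$ has as a pole over all minors of $G$. The structural complexity $\varphi_{\mathcal G}$ is the maximum of $\varphi$ over all choices of the real edge weights. Let $\nu(\mathcal G)$ be the matching number of $\mathcal G$, i.e. the largest cardinality of a set of directed edges no two of which share a common start node or a common end node, and let $S(\mathcal G)$ be the set of sink nodes (nodes with no outgoing edges).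 Then the maximum defining $\varphi_{\mathcal G}$ exists and $$\nu(\mathcal G)\le\varphi_{\mathcal G}\le n-|S(\mathcal G)|.$$ Moreover, $\varphi_{\mathcal G}=\nu(\mathcal G)$ if all $\gamma_i$ are identical, and $\varphi_{\mathcal G}=n-|S(\mathcal G)|$ if all $\gamma_i$ are distinct. -/

import Mathlib

open scoped Classical in
/-- The number of edges of `G` pointing out of `v`. -/
noncomputable def outDegree {n : ℕ} (G : Digraph (Fin n)) (v : Fin n) : ℕ :=
  (Finset.univ.filter fun w : Fin n => G.Adj v w).card

open scoped Classical in
/-- The set of sink nodes: the nodes without outgoing edges. -/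
noncomputable def sinks {n : ℕ} (G : Digraph (Fin n)) : Finset (Fin n) :=
  Finset.univ.filter fun v => outDegree G v = 0

/-- A set of directed edges of `G`, no two of which share a start node or share an end node. -/
def IsDiMatching {n : ℕ} (G : Digraph (Fin n)) (M : Finset (Fin n × Fin n)) : Prop :=
  (∀ e ∈ M, G.Adj e.1 e.2) ∧
    ∀ e ∈ M, ∀ e' ∈ M, e ≠ e' → e.1 ≠ e'.1 ∧ e.2 ≠ e'.2

open scoped Classical in
/-- The matching number of `G`: the largest cardinality of a matching. -/
noncomputable def matchingNumber {n : ℕ} (G : Digraph (Fin n)) : ℕ :=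
  (Finset.univ.filter fun M : Finset (Fin n × Fin n) => IsDiMatching G M).sup Finset.card

/-- The multiplicity of `p ∈ ℂ ∪ {∞}` as a pole of the real rational function `f`
(`0` if `p` is not a pole). The numerator and the denominator of `f` are coprime, and the
multiplicity at infinity is the degree of the numerator minus that of the denominator,
when this is positive. -/
noncomputable def poleOrder (f : RatFunc ℝ) : OnePoint ℂ → ℕ
  | .infty => f.intDegree.toNat
  | .some a => (f.denom.map (algebraMap ℝ ℂ)).rootMultiplicity a

/-- `p` is a pole of the rational matrix `G` if it is a pole of some entry. -/
def IsMatrixPole {q m : ℕ} (G : Matrix (Fin q) (Fin m) (RatFunc ℝ)) (p : OnePoint ℂ) : Prop :=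
  ∃ i j, 0 < poleOrder (G i j) p

theorem finite_matrixPoles {q m : ℕ} (G : Matrix (Fin q) (Fin m) (RatFunc ℝ)) :
    {p | IsMatrixPole G p}.Finite := by
  have h : {p | IsMatrixPole G p} = ⋃ i, ⋃ j, {p | 0 < poleOrder (G i j) p} := by
    ext p
    simp [IsMatrixPole]
  rw [h]
  refine Set.finite_iUnion fun i => Set.finite_iUnion fun j => ?_
  refine (((((G i j).denom.map (algebraMap ℝ ℂ)).roots.toFinset.finite_toSet.image
    (OnePoint.some : ℂ → OnePoint ℂ)).insert OnePoint.infty)).subset ?_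
  intro p hp
  cases p with
  | infty => exact Set.mem_insert _ _
  | coe a =>
    refine Set.mem_insert_of_mem _ ⟨a, ?_, rfl⟩
    have h1 : 0 < ((G i j).denom.map (algebraMap ℝ ℂ)).rootMultiplicity a := hp
    have h2 := Polynomial.rootMultiplicity_pos'.mp h1
    simpa [Polynomial.mem_roots'] using h2

open scoped Classical in
/-- The degree of `p` as a pole of `G`: the largest multiplicity that `p` has as a pole over all
minors of `G`. A minor of order `k` is given by `k` rows and `k` columns, in increasing order. -/
noncomputable def poleDegree {q m : ℕ} (G : Matrix (Fin q) (Fin m) (RatFunc ℝ))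
    (p : OnePoint ℂ) : ℕ :=
  (Finset.range (min q m + 1)).sup fun k =>
    (Finset.univ : Finset (Fin k ↪o Fin q)).sup fun r =>
      (Finset.univ : Finset (Fin k ↪o Fin m)).sup fun c =>
        poleOrder (G.submatrix r c).det p

/-- The McMillan degree: the sum of the degrees of the distinct poles, including infinity. -/
noncomputable def mcMillanDegree {q m : ℕ} (G : Matrix (Fin q) (Fin m) (RatFunc ℝ)) : ℕ :=
  ∑ p ∈ (finite_matrixPoles G).toFinset, poleDegree G p

open scoped Classical in
/-- The matrix `A` of the network with graph `G` and weights `a`: the entry `(i, j)` is the weight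
`a i j` if `(j, i)` is an edge, and `0` otherwise. -/
noncomputable def networkMatrix {n : ℕ} (G : Digraph (Fin n)) (a : Fin n → Fin n → ℝ) :
    Matrix (Fin n) (Fin n) ℝ :=
  Matrix.of fun i j => if G.Adj j i then a i j else 0

/-- The matrix `sI - Γ - A` over `ℝ(s)`, where `Γ = diag γ`. -/
noncomputable def pencil {n : ℕ} (γ : Fin n → ℝ) (A : Matrix (Fin n) (Fin n) ℝ) :
    Matrix (Fin n) (Fin n) (RatFunc ℝ) :=
  Matrix.scalar (Fin n) RatFunc.X - (Matrix.diagonal γ).map RatFunc.C - A.map RatFunc.C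

/-- The matrix `sI - Γ - A` is invertible over `ℝ(s)`, so that its inverse is the genuine one. -/
theorem isUnit_det_pencil {n : ℕ} (γ : Fin n → ℝ) (A : Matrix (Fin n) (Fin n) ℝ) :
    IsUnit (pencil γ A).det := by
  have h : pencil γ A =
      (algebraMap (Polynomial ℝ) (RatFunc ℝ)).mapMatrix (Matrix.diagonal γ + A).charmatrix := by
    ext i j
    by_cases hij : i = j
    · subst hij
      simp [pencil, Matrix.charmatrix, sub_sub]
    · simp [pencil, Matrix.charmatrix, hij]
  rw [h, ← RingHom.map_det]
  exact (RatFunc.algebraMap_ne_zero (Matrix.charpoly_monic _).ne_zero).isUnit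

/-- The transfer function `W(s) = (sI - Γ - A)⁻¹`. -/
noncomputable def transferFunction {n : ℕ} (γ : Fin n → ℝ) (A : Matrix (Fin n) (Fin n) ℝ) :
    Matrix (Fin n) (Fin n) (RatFunc ℝ) :=
  (pencil γ A)⁻¹

/-- The local inverse filter `F(s) = sI - Γ`. -/
noncomputable def localFilter {n : ℕ} (γ : Fin n → ℝ) : Matrix (Fin n) (Fin n) (RatFunc ℝ) :=
  Matrix.scalar (Fin n) RatFunc.X - (Matrix.diagonal γ).map RatFunc.C

/-- The complexity of the network system: the McMillan degree of `F(s) W(s)`. -/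
noncomputable def complexity {n : ℕ} (γ : Fin n → ℝ) (A : Matrix (Fin n) (Fin n) ℝ) : ℕ :=
  mcMillanDegree (localFilter γ * transferFunction γ A)

/-- The complexities of the network system over all choices of the edge weights of `G`. -/
def complexityValues {n : ℕ} (γ : Fin n → ℝ) (G : Digraph (Fin n)) : Set ℕ :=
  Set.range fun a : Fin n → Fin n → ℝ => complexity γ (networkMatrix G a)

/-- The structural complexity: the maximum of the complexity over all edge weights of `G`. -/
noncomputable def structuralComplexity {n : ℕ} (γ : Fin n → ℝ) (G : Digraph (Fin n)) : ℕ :=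
  sSup (complexityValues γ G)

/-! Everything rests on an exact formula (`complexity_eq_sum_levelRank`): the complexity is the sum,
over the distinct values `t` of `γ`, of the rank of the columns of `A` whose index satisfies `γ i =
t`.

Let `χ` be the characteristic polynomial of `Γ + A`. By a Cramer-type identity
(`det_submatrix_mul_charpoly`), each minor of `(sI - Γ)(sI - Γ - A)⁻¹` is `minorNum / χ`, so the
degree of `a` as a pole is the multiplicity of `a` in `χ` minus the least multiplicity of `a` in a
nonzero `minorNum`. That least multiplicity is `levelCard - levelRank`: kernel vectors of the column
block force it (`pow_dvd_minorNum`), and a maximal nonsingular block attains it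
(`exists_minorNum_rootMultiplicity`). There is no pole at infinity. On summing over `a`, the
multiplicities in `χ` and the level cardinalities both total `n` and cancel, leaving the level
ranks.

The rest is linear algebra. Sinks give zero columns, hence the upper bound. The level ranks add up
to at least the rank of `A`, which weights supported on a maximum matching raise to `ν`; for
constant `γ` the sum is at most the rank, and the Leibniz formula bounds that by `ν`. For distinct
`γ i` each level is a single column, nonzero at every non-sink when all weights are `1`. -/

/-! ### Row replacement and minors -/

section ReplaceRows

variable {n k : ℕ} {R S : Type*}

/-- The matrix obtained from `Y` by replacing, for each `l`, the row with index `c l` by the row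
of `X` with index `l`. -/
noncomputable def replaceRows (c : Fin k → Fin n) (X : Matrix (Fin k) (Fin n) R)
    (Y : Matrix (Fin n) (Fin n) R) : Matrix (Fin n) (Fin n) R :=
  Matrix.of fun i j => Function.extend c (fun l => X l j) (fun i => Y i j) i

theorem replaceRows_apply {c : Fin k → Fin n} (hc : Function.Injective c)
    (X : Matrix (Fin k) (Fin n) R) (Y : Matrix (Fin n) (Fin n) R) (l : Fin k) (j : Fin n) :
    replaceRows c X Y (c l) j = X l j :=
  hc.extend_apply (fun l => X l j) (fun i => Y i j) l

theorem replaceRows_apply_of_notMem {c : Fin k → Fin n} (X : Matrix (Fin k) (Fin n) R)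
    (Y : Matrix (Fin n) (Fin n) R) {i : Fin n} (hi : ¬∃ l, c l = i) (j : Fin n) :
    replaceRows c X Y i j = Y i j :=
  Function.extend_apply' (fun l => X l j) (fun i => Y i j) i hi

variable [CommRing R] [CommRing S]

theorem replaceRows_mul {c : Fin k → Fin n} (hc : Function.Injective c)
    (X : Matrix (Fin k) (Fin n) R) (Y P : Matrix (Fin n) (Fin n) R) :
    replaceRows c X Y * P = replaceRows c (X * P) (Y * P) := by
  ext i j
  by_cases hi : ∃ l, c l = i
  · obtain ⟨l, rfl⟩ := hi
    simp only [Matrix.mul_apply, replaceRows_apply hc]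
  · simp only [Matrix.mul_apply, replaceRows_apply_of_notMem _ _ hi]

theorem replaceRows_map {c : Fin k → Fin n} (hc : Function.Injective c)
    (r : Fin k → Fin n) (X Y : Matrix (Fin n) (Fin n) R) (f : R →+* S) :
    f.mapMatrix (replaceRows c (X.submatrix r id) Y) =
      replaceRows c ((f.mapMatrix X).submatrix r id) (f.mapMatrix Y) := by
  ext i j
  by_cases hi : ∃ l, c l = i
  · obtain ⟨l, rfl⟩ := hi
    simp [replaceRows_apply hc]
  · simp [replaceRows_apply_of_notMem _ _ hi]

/-- Rows outside the range of `c` are rows of the identity, so the matrix is block triangular with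
an identity block; the other block is the submatrix, reindexed along `c`. -/
theorem det_replaceRows_one {c : Fin k → Fin n} (hc : Function.Injective c)
    (r : Fin k → Fin n) (X : Matrix (Fin n) (Fin n) R) :
    (replaceRows c (X.submatrix r id) 1).det = (X.submatrix r c).det := by
  classical
  rw [Matrix.twoBlockTriangular_det _ (fun i => ∃ l, c l = i)]
  · have h2 : (replaceRows c (X.submatrix r id) 1).toSquareBlockProp
        (fun i => ¬∃ l, c l = i) = 1 := by
      ext i j
      change replaceRows c (X.submatrix r id) 1 i j = _
      rw [replaceRows_apply_of_notMem _ _ i.2]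
      simp [Matrix.one_apply, Subtype.ext_iff]
    let e : Fin k ≃ {a // ∃ l, c l = a} := Equiv.ofInjective c hc
    rw [h2, Matrix.det_one, mul_one]
    refine (Matrix.det_submatrix_equiv_self e _).symm.trans ?_
    congr 1
    ext l l'
    change replaceRows c (X.submatrix r id) 1 (c l) (c l') = X (r l) (c l')
    rw [replaceRows_apply hc, Matrix.submatrix_apply, id]
  · rintro i hi j hj
    rw [replaceRows_apply_of_notMem _ _ hi, Matrix.one_apply_ne]
    rintro rfl
    exact hi hj

end ReplaceRows

/-! ### Numerators of the minors over a common denominator -/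

section PolynomialPencil

open Polynomial

variable {n k : ℕ} {K L : Type*} [Field K] [Field L]

/-- The polynomial matrix `sI - Γ`. -/
noncomputable def polyFilter (γ : Fin n → K) : Matrix (Fin n) (Fin n) K[X] :=
  Matrix.diagonal fun i => X - C (γ i)

/-- The polynomial matrix `sI - Γ - A`. -/
noncomputable def polyPencil (γ : Fin n → K) (A : Matrix (Fin n) (Fin n) K) :
    Matrix (Fin n) (Fin n) K[X] :=
  polyFilter γ - A.map C

/-- The determinant of `sI - Γ - A` after the rows `c l` are replaced by the rows `r l`
of `sI - Γ`. -/
noncomputable def minorNum (γ : Fin n → K) (A : Matrix (Fin n) (Fin n) K)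
    (r c : Fin k → Fin n) : K[X] :=
  (replaceRows c ((polyFilter γ).submatrix r id) (polyPencil γ A)).det

theorem polyFilter_map (γ : Fin n → K) (f : K →+* L) :
    (mapRingHom f).mapMatrix (polyFilter γ) = polyFilter (fun i => f (γ i)) := by
  ext i j : 2
  by_cases h : i = j
  · subst h; simp [polyFilter]
  · simp [polyFilter, h]

theorem polyPencil_map (γ : Fin n → K) (A : Matrix (Fin n) (Fin n) K) (f : K →+* L) :
    (mapRingHom f).mapMatrix (polyPencil γ A) = polyPencil (fun i => f (γ i)) (A.map f) := by
  rw [polyPencil, map_sub, polyFilter_map, polyPencil]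
  congr 1
  ext i j : 2
  simp

/-- The data are real but the poles are complex; this moves the numerators to `ℂ`, where their roots
are counted. -/
theorem minorNum_map (γ : Fin n → K) (A : Matrix (Fin n) (Fin n) K)
    (r : Fin k → Fin n) {c : Fin k → Fin n} (hc : Function.Injective c) (f : K →+* L) :
    (minorNum γ A r c).map f = minorNum (fun i => f (γ i)) (A.map f) r c := by
  rw [← coe_mapRingHom, minorNum, RingHom.map_det, replaceRows_map hc, polyFilter_map,
    polyPencil_map, minorNum]

theorem polyPencil_eq_charmatrix (γ : Fin n → K) (A : Matrix (Fin n) (Fin n) K) :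
    polyPencil γ A = (Matrix.diagonal γ + A).charmatrix := by
  ext i j : 2
  by_cases h : i = j
  · subst h; simp [polyPencil, polyFilter, Matrix.charmatrix, sub_sub]
  · simp [polyPencil, polyFilter, Matrix.charmatrix, h]

theorem det_polyPencil (γ : Fin n → K) (A : Matrix (Fin n) (Fin n) K) :
    (polyPencil γ A).det = (Matrix.diagonal γ + A).charpoly := by
  rw [polyPencil_eq_charmatrix, Matrix.charpoly]

/-- The matrix is `X • B + B'` with constant `B` and `B'`, so its determinant has degree at most its
size. This excludes a pole at infinity. -/
theorem natDegree_minorNum_le (γ : Fin n → K) (A : Matrix (Fin n) (Fin n) K)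
    (r : Fin k → Fin n) {c : Fin k → Fin n} (hc : Function.Injective c) :
    (minorNum γ A r c).natDegree ≤ n := by
  have key : replaceRows c ((polyFilter γ).submatrix r id) (polyPencil γ A) =
      (X : K[X]) • (replaceRows c ((1 : Matrix (Fin n) (Fin n) K).submatrix r id) 1).map C +
        (replaceRows c ((-Matrix.diagonal γ).submatrix r id) (-Matrix.diagonal γ - A)).map C := by
    ext i j : 2
    by_cases hi : ∃ l, c l = i
    · obtain ⟨l, rfl⟩ := hi
      by_cases h : r l = j
      · subst h
        have h1 : (1 : Matrix (Fin n) (Fin n) K) (r l) (id (r l)) = 1 := Matrix.one_apply_eq _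
        simp [replaceRows_apply hc, polyFilter, sub_eq_add_neg, h1]
      · simp [replaceRows_apply hc, polyFilter, h]
    · by_cases h : i = j
      · subst h
        simp [replaceRows_apply_of_notMem _ _ hi, polyFilter, polyPencil]
        ring
      · simp [replaceRows_apply_of_notMem _ _ hi, polyFilter, polyPencil, h]
  rw [minorNum, key]
  simpa using natDegree_det_X_add_C_le
    (replaceRows c ((1 : Matrix (Fin n) (Fin n) K).submatrix r id) 1)
    (replaceRows c ((-Matrix.diagonal γ).submatrix r id) (-Matrix.diagonal γ - A))

theorem localFilter_eq (γ : Fin n → ℝ) :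
    localFilter γ = (algebraMap ℝ[X] (RatFunc ℝ)).mapMatrix (polyFilter γ) := by
  ext i j : 2
  by_cases h : i = j
  · subst h; simp [polyFilter, localFilter]
  · simp [polyFilter, localFilter, h]

theorem pencil_eq (γ : Fin n → ℝ) (A : Matrix (Fin n) (Fin n) ℝ) :
    pencil γ A = (algebraMap ℝ[X] (RatFunc ℝ)).mapMatrix (polyPencil γ A) := by
  rw [polyPencil, map_sub, ← localFilter_eq, pencil, localFilter]
  congr 1

/-- Write the minor as the determinant of an identity matrix with rows replaced by rows of `F W`,
then multiply on the right by `sI - Γ - A`: rows of `F W` become rows of `F`, and rows of the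
identity become rows of the pencil. -/
theorem det_submatrix_mul_charpoly (γ : Fin n → ℝ) (A : Matrix (Fin n) (Fin n) ℝ)
    (r : Fin k → Fin n) {c : Fin k → Fin n} (hc : Function.Injective c) :
    ((localFilter γ * transferFunction γ A).submatrix r c).det *
        algebraMap ℝ[X] (RatFunc ℝ) (Matrix.diagonal γ + A).charpoly =
      algebraMap ℝ[X] (RatFunc ℝ) (minorNum γ A r c) := by
  have h (M P : Matrix (Fin n) (Fin n) (RatFunc ℝ)) :
      M.submatrix r id * P = (M * P).submatrix r id := by
    ext i j; simp [Matrix.mul_apply]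
  rw [← det_replaceRows_one hc, ← det_polyPencil, RingHom.map_det, ← pencil_eq, ← Matrix.det_mul,
    replaceRows_mul hc, h, one_mul, transferFunction,
    Matrix.nonsing_inv_mul_cancel_right _ _ (isUnit_det_pencil γ A), minorNum, RingHom.map_det,
    replaceRows_map hc, ← localFilter_eq, ← pencil_eq]

end PolynomialPencil

/-! ### Least multiplicity of a root among the numerators -/

section LevelRank

open Polynomial

variable {n k : ℕ} {K : Type*} [Field K]

/-- The number of indices `i` with `γ i = t`. -/
noncomputable def levelCard (γ : Fin n → K) (t : K) : ℕ :=
  Nat.card {i // γ i = t}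

/-- The rank of the columns of `A` whose index `i` satisfies `γ i = t`. -/
noncomputable def levelRank (γ : Fin n → K) (A : Matrix (Fin n) (Fin n) K) (t : K) : ℕ :=
  Module.finrank K (Submodule.span K (Set.range fun i : {i // γ i = t} => A.col i))

theorem levelRank_eq_rank (γ : Fin n → K) (A : Matrix (Fin n) (Fin n) K) (t : K)
    [Fintype {i // γ i = t}] :
    levelRank γ A t = (A.submatrix id (Subtype.val : {i // γ i = t} → Fin n)).rank := by
  rw [Matrix.rank_eq_finrank_span_cols]
  rfl

theorem levelRank_le_levelCard (γ : Fin n → K) (A : Matrix (Fin n) (Fin n) K) (t : K) :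
    levelRank γ A t ≤ levelCard γ t := by
  classical
  rw [levelRank_eq_rank, levelCard, Nat.card_eq_fintype_card]
  exact Matrix.rank_le_card_width _

theorem pow_card_dvd_det {R : Type*} [CommRing R] (M : Matrix (Fin n) (Fin n) R)
    (S : Finset (Fin n)) (p : R) (h : ∀ i ∈ S, ∀ x, p ∣ M x i) : p ^ S.card ∣ M.det := by
  classical
  choose! q hq using h
  have hM : M = Matrix.of (fun x i => if i ∈ S then q i x else M x i) *
      Matrix.diagonal (fun i => if i ∈ S then p else 1) := by
    ext x i
    rw [Matrix.mul_diagonal]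
    by_cases hi : i ∈ S
    · simp [hi, hq i hi x, mul_comm]
    · simp [hi]
  rw [hM, Matrix.det_mul, Matrix.det_diagonal, Finset.prod_ite_mem, Finset.univ_inter,
    Finset.prod_const]
  exact dvd_mul_left _ _

/-- Some invertible constant matrix has `levelCard γ t - levelRank γ A t` columns annihilated by
both `Γ - t` and `A`. -/
theorem exists_isUnit_det_kernel_columns (γ : Fin n → K) (A : Matrix (Fin n) (Fin n) K) (t : K) :
    ∃ (Q : Matrix (Fin n) (Fin n) K) (S : Finset (Fin n)), IsUnit Q.det ∧
      S.card = levelCard γ t - levelRank γ A t ∧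
      ∀ i ∈ S, (∀ x, (A * Q) x i = 0) ∧ ∀ x, γ x ≠ t → Q x i = 0 := by
  classical
  set B := A.submatrix id (Subtype.val : {i // γ i = t} → Fin n) with hB
  have hfin := LinearMap.finrank_range_add_finrank_ker B.mulVecLin
  rw [← Matrix.rank, Module.finrank_fintype_fun_eq_card] at hfin
  -- The columns of `Q` are a basis of the kernel of the block `B`, extended by zero to all indices,
  -- then completed to a basis of the whole space.
  let b := Module.finBasis K B.mulVecLin.ker
  let E := Function.ExtendByZero.linearMap K (Subtype.val : {i // γ i = t} → Fin n)
  have hE : Function.Injective E := by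
    intro v w hvw
    ext i
    have := congrFun hvw i
    simpa [E, Subtype.val_injective.extend_apply] using this
  have hli : LinearIndependent K (fun l => E (b l)) := by
    have h1 := b.linearIndependent.map' (Submodule.subtype _) (Submodule.ker_subtype _)
    exact h1.map' E (LinearMap.ker_eq_bot.mpr hE)
  let bs := Module.Basis.sumExtend hli
  let e := (Pi.basisFun K (Fin n)).indexEquiv bs
  let b2 := bs.reindex e.symm
  refine ⟨(Pi.basisFun K (Fin n)).toMatrix b2,
    Finset.univ.map ⟨fun l => e.symm (Sum.inl l), fun _ _ h => by simpa using h⟩, ?_, ?_, ?_⟩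
  · rw [← Module.Basis.det_apply]
    exact (Pi.basisFun K (Fin n)).isUnit_det b2
  · rw [Finset.card_map, Finset.card_univ, Fintype.card_fin, levelCard, levelRank_eq_rank,
      Nat.card_eq_fintype_card, ← hB]
    omega
  · intro i hi
    obtain ⟨l, -, rfl⟩ := Finset.mem_map.mp hi
    have hbs : bs (Sum.inl l) = E (b l) := by
      simp only [bs, Module.Basis.sumExtend, Module.Basis.reindex_apply,
        Module.Basis.extend_apply_self]
      rfl
    have hcol : ∀ x, (Pi.basisFun K (Fin n)).toMatrix b2 x (e.symm (Sum.inl l)) = E (b l) x := by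
      intro x
      simp only [Module.Basis.toMatrix_apply, b2, Module.Basis.reindex_apply, Equiv.symm_symm,
        Equiv.apply_symm_apply, Pi.basisFun_repr, hbs]
    have hz : ∀ x, γ x ≠ t → E (b l) x = 0 := by
      intro x hx
      have : ¬∃ a : {i // γ i = t}, a.1 = x := by
        rintro ⟨a, rfl⟩; exact hx a.2
      simp [E, Function.extend_apply' _ _ _ this]
    refine ⟨fun x => ?_, fun x hx => (hcol x).trans (hz x hx)⟩
    change ∑ y, A x y * (Pi.basisFun K (Fin n)).toMatrix b2 y (e.symm (Sum.inl l)) = 0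
    simp_rw [hcol]
    have hker : B.mulVec (b l) x = 0 := congrFun (LinearMap.mem_ker.mp (b l).2) x
    rw [← hker, Matrix.mulVec, dotProduct]
    refine (Fintype.sum_of_injective Subtype.val Subtype.val_injective _ _ ?_ ?_).symm
    · intro y hy
      have : γ y ≠ t := fun h => hy ⟨⟨y, h⟩, rfl⟩
      simp [hz y this]
    · intro y
      simp [hB, E]

/-- After right multiplication by `Q`, the columns in `S` are killed by `A`, so replaced and
original rows alike contribute only `(sI - Γ) Q`, whose entries there are multiples of `X - C t`. -/
theorem pow_dvd_minorNum (γ : Fin n → K) (A : Matrix (Fin n) (Fin n) K) (t : K)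
    (r : Fin k → Fin n) {c : Fin k → Fin n} (hc : Function.Injective c) :
    (X - C t) ^ (levelCard γ t - levelRank γ A t) ∣ minorNum γ A r c := by
  obtain ⟨Q, S, hQ, hS, hk⟩ := exists_isUnit_det_kernel_columns γ A t
  have hD : ∀ i ∈ S, ∀ y, X - C t ∣ (polyFilter γ * Q.map C) y i := by
    intro i hi y
    rw [polyFilter, Matrix.diagonal_mul, Matrix.map_apply]
    by_cases hy : γ y = t
    · rw [hy]; exact dvd_mul_right _ _
    · simp [(hk i hi).2 y hy]
  have hA : ∀ i ∈ S, ∀ y, (A.map C * Q.map C) y i = 0 := by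
    intro i hi y
    rw [← Matrix.map_mul, Matrix.map_apply, (hk i hi).1 y, C_0]
  have h := pow_card_dvd_det
    (replaceRows c ((polyFilter γ).submatrix r id) (polyPencil γ A) * Q.map C) S (X - C t) (by
      intro i hi x
      rw [replaceRows_mul hc]
      by_cases hx : ∃ l, c l = x
      · obtain ⟨l, rfl⟩ := hx
        rw [replaceRows_apply hc]
        exact hD i hi _
      · rw [replaceRows_apply_of_notMem _ _ hx, polyPencil, Matrix.sub_mul, Matrix.sub_apply,
          hA i hi, sub_zero]
        exact hD i hi _)
  rw [Matrix.det_mul, hS] at h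
  have hu : IsUnit (Q.map (C : K →+* K[X])).det := by
    have := hQ.map (C : K →+* K[X])
    rwa [RingHom.map_det] at this
  exact (hu.dvd_mul_right).mp h

/-- A set `J` of indices with `γ i = t` and a set `I` of rows, both of cardinality
`levelRank γ A t`, such that the submatrix of `A` with rows `I` and columns `J` is nonsingular. -/
theorem exists_nonsingular_block (γ : Fin n → K) (A : Matrix (Fin n) (Fin n) K) (t : K) :
    ∃ I J : Finset (Fin n), I.card = J.card ∧ J.card = levelRank γ A t ∧ (∀ j ∈ J, γ j = t) ∧
      ∀ v : Fin n → K, (∀ j ∉ J, v j = 0) → (∀ i ∈ I, (A.mulVec v) i = 0) → v = 0 := by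
  classical
  set B := A.submatrix id (Subtype.val : {i // γ i = t} → Fin n) with hB
  -- Select independent columns spanning the column space, then, within them, independent rows
  -- spanning the row space; row rank equals column rank, so the block is square.
  obtain ⟨κ, a, ha, hspan, hli⟩ := exists_linearIndependent' K B.col
  have : Finite κ := Finite.of_injective a ha
  have := Fintype.ofFinite κ
  have hκ : Fintype.card κ = levelRank γ A t := by
    rw [levelRank_eq_rank, ← hB, Matrix.rank_eq_finrank_span_cols, ← hspan, finrank_span_eq_card hli]
  set F := B.submatrix id a with hF
  have hFcol : F.col = B.col ∘ a := rfl
  obtain ⟨κ', a', ha', hspan', hli'⟩ := exists_linearIndependent' K F.row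
  have : Finite κ' := Finite.of_injective a' ha'
  have := Fintype.ofFinite κ'
  have hκ' : Fintype.card κ' = Fintype.card κ := by
    rw [← finrank_span_eq_card hli', hspan', ← Matrix.rank_eq_finrank_span_row,
      Matrix.rank_eq_finrank_span_cols, hFcol, finrank_span_eq_card hli]
  refine ⟨Finset.univ.map ⟨a', ha'⟩,
    Finset.univ.map ⟨fun x => (a x).1, Subtype.val_injective.comp ha⟩, ?_, ?_, ?_, ?_⟩
  · simpa using hκ'
  · simpa using hκ
  · intro j hj
    obtain ⟨x, -, rfl⟩ := Finset.mem_map.mp hj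
    exact (a x).2
  · intro v hv hI
    have hmul : ∀ i, (A.mulVec v) i = F.row i ⬝ᵥ fun x => v (a x).1 := by
      intro i
      rw [Matrix.mulVec, dotProduct, dotProduct]
      refine (Fintype.sum_of_injective (fun x => (a x).1) (Subtype.val_injective.comp ha)
        _ _ ?_ ?_).symm
      · intro j hj
        rw [hv j, mul_zero]
        simpa using hj
      · intro x
        rfl
    have hrow : ∀ u ∈ Submodule.span K (Set.range F.row), u ⬝ᵥ (fun x => v (a x).1) = 0 := by
      rw [← hspan']
      intro u hu
      induction hu using Submodule.span_induction with
      | mem u hu =>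
        obtain ⟨l, rfl⟩ := hu
        rw [Function.comp_apply, ← hmul]
        exact hI _ (Finset.mem_map_of_mem _ (Finset.mem_univ l))
      | zero => simp
      | add x y _ _ hx hy => rw [add_dotProduct, hx, hy, add_zero]
      | smul s x _ hx => rw [smul_dotProduct, hx, smul_zero]
    have hz := Fintype.linearIndependent_iff.mp hli (fun x => v (a x).1) (by
      ext i
      have h1 := hrow (F.row i) (Submodule.subset_span ⟨i, rfl⟩)
      rw [dotProduct] at h1
      rw [Pi.zero_apply, Finset.sum_apply, ← h1]
      refine Finset.sum_congr rfl fun x _ => ?_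
      exact mul_comm _ _)
    ext j
    by_cases hj : j ∈ Finset.univ.map ⟨fun x => (a x).1, Subtype.val_injective.comp ha⟩
    · obtain ⟨x, -, rfl⟩ := Finset.mem_map.mp hj
      exact hz x
    · exact hv j hj

/-- Replace the rows outside `I` by the rows of `sI - Γ` outside `J`. Each replaced row is a unit
vector times `X - C (γ j)`. With these factors taken out, the matrix `N` is nonsingular at `t`: its
unit rows kill `v` off `J`, and its rows in `I` act on the rest as `-A`. The multiplicity is thus
the number of `j ∉ J` with `γ j = t`. -/
theorem exists_minorNum_rootMultiplicity (γ : Fin n → K) (A : Matrix (Fin n) (Fin n) K) (t : K) :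
    ∃ (k : ℕ) (_ : k ≤ n) (r c : Fin k ↪o Fin n), minorNum γ A r c ≠ 0 ∧
      (minorNum γ A r c).rootMultiplicity t = levelCard γ t - levelRank γ A t := by
  classical
  obtain ⟨I, J, hIJ, hJ, hJt, hv⟩ := exists_nonsingular_block γ A t
  have hk : Jᶜ.card ≤ n := by simpa using Finset.card_le_univ Jᶜ
  have hIk : Iᶜ.card = Jᶜ.card := by rw [Finset.card_compl, Finset.card_compl, hIJ]
  let r := Jᶜ.orderEmbOfFin rfl
  let c := Iᶜ.orderEmbOfFin hIk
  have hr : ∀ j, (∃ l, r l = j) ↔ j ∉ J := by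
    intro j
    rw [← Finset.mem_compl, ← Finset.mem_coe, ← Jᶜ.range_orderEmbOfFin rfl, Set.mem_range]
  have hcI : ∀ j, (∃ l, c l = j) ↔ j ∉ I := by
    intro j
    rw [← Finset.mem_compl, ← Finset.mem_coe, ← Iᶜ.range_orderEmbOfFin hIk, Set.mem_range]
  let N := replaceRows c ((1 : Matrix (Fin n) (Fin n) K[X]).submatrix r id) (polyPencil γ A)
  have hfac : replaceRows c ((polyFilter γ).submatrix r id) (polyPencil γ A) =
      Matrix.diagonal (Function.extend c (fun l => X - C (γ (r l))) 1) * N := by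
    refine Matrix.ext fun i j => ?_
    rw [Matrix.diagonal_mul]
    by_cases hi : ∃ l, c l = i
    · obtain ⟨l, rfl⟩ := hi
      rw [replaceRows_apply c.injective, c.injective.extend_apply]
      simp only [N, replaceRows_apply c.injective]
      change Matrix.diagonal (fun i => X - C (γ i)) (r l) j =
        (X - C (γ (r l))) * (1 : Matrix (Fin n) (Fin n) K[X]) (r l) j
      rw [Matrix.diagonal_apply, Matrix.one_apply, mul_ite, mul_one, mul_zero]
    · rw [replaceRows_apply_of_notMem _ _ hi, Function.extend_apply' _ _ _ hi]
      simp only [N, replaceRows_apply_of_notMem _ _ hi, Pi.one_apply, one_mul]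
  have hprod : ∏ i, Function.extend c (fun l => X - C (γ (r l))) 1 i = ∏ j ∈ Jᶜ, (X - C (γ j)) := by
    rw [← Fintype.prod_of_injective c c.injective (fun l => X - C (γ (r l)))]
    · refine (Finset.prod_image (f := fun j => X - C (γ j)) r.injective.injOn).symm.trans ?_
      rw [Finset.image_orderEmbOfFin_univ]
    · intro i hi
      rw [Function.extend_apply' _ _ _ hi, Pi.one_apply]
    · intro l
      rw [c.injective.extend_apply]
  have hN : N.det.eval t ≠ 0 := by
    rw [← coe_evalRingHom, RingHom.map_det]
    intro h0
    obtain ⟨v, hv0, hmv⟩ := Matrix.exists_mulVec_eq_zero_iff.mpr h0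
    apply hv0
    have hout : ∀ j ∉ J, v j = 0 := by
      intro j hj
      obtain ⟨l, rfl⟩ := (hr j).mpr hj
      have h1 := congrFun hmv (c l)
      have h2 : ∀ x, ((evalRingHom t).mapMatrix N) (c l) x =
          (1 : Matrix (Fin n) (Fin n) K) (r l) x := by
        intro x
        simp only [RingHom.mapMatrix_apply, Matrix.map_apply, N, replaceRows_apply c.injective]
        change evalRingHom t ((1 : Matrix (Fin n) (Fin n) K[X]) (r l) x) = _
        rw [Matrix.one_apply, Matrix.one_apply, apply_ite (evalRingHom t), map_one, map_zero]
      simp only [Matrix.mulVec, dotProduct, h2] at h1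
      simpa [Matrix.one_apply] using h1
    refine hv v hout fun i hi => ?_
    have h1 := congrFun hmv i
    have hi' : ¬∃ l, c l = i := fun h => (hcI i).mp h hi
    have h2 : ∀ x, ((evalRingHom t).mapMatrix N) i x * v x = -(A i x * v x) := by
      intro x
      simp only [RingHom.mapMatrix_apply, Matrix.map_apply, N,
        replaceRows_apply_of_notMem _ _ hi', polyPencil, polyFilter, Matrix.sub_apply]
      -- The diagonal term `(t - γ i) * v i` vanishes: either `i ∈ J` and `γ i = t`, or `v i = 0`.
      by_cases hx : i = x
      · subst hx
        by_cases hiJ : i ∈ J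
        · simp [hJt i hiJ]
        · simp [hout i hiJ]
      · simp [hx]
    simp only [Matrix.mulVec, dotProduct, h2, Finset.sum_neg_distrib, Pi.zero_apply,
      neg_eq_zero] at h1
    exact h1
  have hNne : N.det ≠ 0 := fun h => hN (by rw [h, eval_zero])
  have hpne : ∏ j ∈ Jᶜ, (X - C (γ j)) ≠ 0 :=
    Finset.prod_ne_zero_iff.mpr fun j _ => X_sub_C_ne_zero _
  have hdet : minorNum γ A r c = (∏ j ∈ Jᶜ, (X - C (γ j))) * N.det := by
    rw [minorNum, hfac, Matrix.det_mul, Matrix.det_diagonal, hprod]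
  refine ⟨_, hk, r, c, ?_, ?_⟩
  · rw [hdet]; exact mul_ne_zero hpne hNne
  · rw [hdet, rootMultiplicity_mul (mul_ne_zero hpne hNne), rootMultiplicity_eq_zero hN, add_zero,
      ← count_roots, roots_prod _ _ hpne]
    simp only [roots_X_sub_C]
    rw [Multiset.bind_singleton, Multiset.count_map, levelCard, Nat.card_eq_fintype_card,
      Fintype.card_subtype, ← hJ,
      ← Finset.card_sdiff_of_subset (fun j hj => by simpa using hJt j hj)]
    change (Finset.filter (fun a => t = γ a) Jᶜ).card = _
    congr 1
    ext j
    simp [and_comm, eq_comm]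

end LevelRank

/-! ### Pole degrees and the rank formula for the complexity -/

section PoleDegree

open Polynomial

variable {n k : ℕ}

/-- The pole multiplicity of `f` at a finite point from a not necessarily reduced fraction. -/
theorem poleOrder_coe_of_mul_eq {f : RatFunc ℝ} {p q : ℝ[X]} (hp : p ≠ 0) (hq : q ≠ 0)
    (h : f * algebraMap ℝ[X] (RatFunc ℝ) q = algebraMap ℝ[X] (RatFunc ℝ) p) (a : ℂ) :
    poleOrder f (a : OnePoint ℂ) = (q.map (algebraMap ℝ ℂ)).rootMultiplicity a -
      (p.map (algebraMap ℝ ℂ)).rootMultiplicity a := by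
  have hq' := RatFunc.algebraMap_ne_zero hq
  have h1 : f.num * q = p * f.denom :=
    (RatFunc.num_mul_eq_mul_denom_iff hq).mpr ((eq_div_iff hq').mpr h)
  have hd : f.denom ≠ 0 := f.denom_ne_zero
  have hn : f.num ≠ 0 := by
    intro h0
    rw [h0, zero_mul] at h1
    exact mul_ne_zero hp hd h1.symm
  have hinj := (algebraMap ℝ ℂ).injective
  have hm : ∀ {g : ℝ[X]}, g ≠ 0 → g.map (algebraMap ℝ ℂ) ≠ 0 := fun hg =>
    (Polynomial.map_ne_zero_iff hinj).mpr hg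
  have h2 := congrArg (fun g => (g.map (algebraMap ℝ ℂ)).rootMultiplicity a) h1
  simp only [Polynomial.map_mul] at h2
  rw [rootMultiplicity_mul (mul_ne_zero (hm hn) (hm hq)),
    rootMultiplicity_mul (mul_ne_zero (hm hp) (hm hd))] at h2
  -- By coprimality at most one of numerator and denominator vanishes at `a`, which makes the
  -- truncated subtraction correct.
  have h3 : (f.num.map (algebraMap ℝ ℂ)).rootMultiplicity a = 0 ∨
      (f.denom.map (algebraMap ℝ ℂ)).rootMultiplicity a = 0 := by
    obtain ⟨u, v, huv⟩ := (f.isCoprime_num_denom).map (mapRingHom (algebraMap ℝ ℂ))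
    simp only [coe_mapRingHom] at huv
    by_contra! hcon
    have e1 := (rootMultiplicity_pos (hm hn)).mp (Nat.pos_of_ne_zero hcon.1)
    have e2 := (rootMultiplicity_pos (hm hd)).mp (Nat.pos_of_ne_zero hcon.2)
    have e3 := congrArg (eval a) huv
    rw [eval_add, eval_mul, eval_mul, e1.eq_zero, e2.eq_zero] at e3
    simp at e3
  change (f.denom.map (algebraMap ℝ ℂ)).rootMultiplicity a = _
  omega

theorem poleOrder_zero (p : OnePoint ℂ) : poleOrder 0 p = 0 := by
  cases p with
  | infty => simp [poleOrder]
  | coe a =>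
    change ((0 : RatFunc ℝ).denom.map (algebraMap ℝ ℂ)).rootMultiplicity a = 0
    rw [RatFunc.denom_zero, Polynomial.map_one, ← C_1, rootMultiplicity_C]

theorem poleOrder_infty_of_mul_eq {f : RatFunc ℝ} {p q : ℝ[X]} (hq : q ≠ 0)
    (h : f * algebraMap ℝ[X] (RatFunc ℝ) q = algebraMap ℝ[X] (RatFunc ℝ) p)
    (hpq : p.natDegree ≤ q.natDegree) : poleOrder f OnePoint.infty = 0 := by
  by_cases hf : f = 0
  · rw [hf, poleOrder_zero]
  have hq' := RatFunc.algebraMap_ne_zero hq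
  have h1 := RatFunc.intDegree_mul hf hq'
  rw [h, RatFunc.intDegree_polynomial, RatFunc.intDegree_polynomial] at h1
  change f.intDegree.toNat = 0
  omega

/-- The real rational functions without a pole at the complex number `a`. -/
noncomputable def regularAt (a : ℂ) : Subring (RatFunc ℝ) where
  carrier := {f | (f.denom.map (algebraMap ℝ ℂ)).eval a ≠ 0}
  mul_mem' := by
    intro f g hf hg h
    have h1 := Polynomial.map_dvd (algebraMap ℝ ℂ) (RatFunc.denom_mul_dvd f g)
    have h2 := eval_dvd (x := a) h1
    rw [h, zero_dvd_iff, Polynomial.map_mul, eval_mul] at h2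
    exact mul_ne_zero hf hg h2
  one_mem' := by simp
  add_mem' := by
    intro f g hf hg h
    have h1 := Polynomial.map_dvd (algebraMap ℝ ℂ) (RatFunc.denom_add_dvd f g)
    have h2 := eval_dvd (x := a) h1
    rw [h, zero_dvd_iff, Polynomial.map_mul, eval_mul] at h2
    exact mul_ne_zero hf hg h2
  zero_mem' := by simp
  neg_mem' := by
    intro f hf h
    have h1 : (-f).denom ∣ f.denom := by
      have h2 := RatFunc.denom_mul_dvd (RatFunc.C (-1)) f
      rwa [RatFunc.denom_C, one_mul, map_neg, map_one, neg_one_mul] at h2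
    have h2 := eval_dvd (x := a) (Polynomial.map_dvd (algebraMap ℝ ℂ) h1)
    rw [h, zero_dvd_iff] at h2
    exact hf h2

theorem mem_regularAt_iff {f : RatFunc ℝ} {a : ℂ} :
    f ∈ regularAt a ↔ poleOrder f (a : OnePoint ℂ) = 0 := by
  have hd : f.denom.map (algebraMap ℝ ℂ) ≠ 0 :=
    (Polynomial.map_ne_zero_iff (algebraMap ℝ ℂ).injective).mpr f.denom_ne_zero
  change _ ≠ 0 ↔ (f.denom.map (algebraMap ℝ ℂ)).rootMultiplicity a = 0
  rw [← not_iff_not, not_not, ← Ne, ← Nat.pos_iff_ne_zero, rootMultiplicity_pos hd, IsRoot]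

theorem det_mem_subring {R : Type*} [CommRing R] (T : Subring R)
    (M : Matrix (Fin k) (Fin k) R) (h : ∀ i j, M i j ∈ T) : M.det ∈ T := by
  let M' : Matrix (Fin k) (Fin k) T := Matrix.of fun i j => ⟨M i j, h i j⟩
  have hM : M = T.subtype.mapMatrix M' := by
    ext i j; rfl
  rw [hM, ← RingHom.map_det]
  exact (M'.det).2

/-- Functions regular at `a` form a ring, so minors of regular entries are regular. Hence the
McMillan sum may run over any larger finite set of points. -/
theorem poleDegree_eq_zero_of_not_isMatrixPole {q m : ℕ}
    {G : Matrix (Fin q) (Fin m) (RatFunc ℝ)} {a : ℂ} (h : ¬IsMatrixPole G (a : OnePoint ℂ)) :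
    poleDegree G (a : OnePoint ℂ) = 0 := by
  simp only [IsMatrixPole, not_exists, not_lt, Nat.le_zero] at h
  rw [← Nat.le_zero, poleDegree]
  refine Finset.sup_le fun k _ => Finset.sup_le fun r _ => Finset.sup_le fun c _ => ?_
  rw [Nat.le_zero, ← mem_regularAt_iff]
  exact det_mem_subring _ _ fun i j => mem_regularAt_iff.mpr (h _ _)

theorem poleOrder_le_poleDegree {q m : ℕ} (G : Matrix (Fin q) (Fin m) (RatFunc ℝ))
    (p : OnePoint ℂ) (hkq : k ≤ q) (hkm : k ≤ m) (r : Fin k ↪o Fin q) (c : Fin k ↪o Fin m) :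
    poleOrder (G.submatrix r c).det p ≤ poleDegree G p := by
  classical
  rw [poleDegree]
  refine le_trans ?_ (Finset.le_sup (b := k)
    (Finset.mem_range.mpr (Nat.lt_succ_of_le (le_min hkq hkm))))
  refine le_trans ?_ (Finset.le_sup (Finset.mem_univ r))
  exact Finset.le_sup (f := fun c : Fin k ↪o Fin m => poleOrder (G.submatrix r c).det p)
    (Finset.mem_univ c)

/-- The degree of `a` as a pole of `(sI - Γ)(sI - Γ - A)⁻¹`. -/
theorem poleDegree_add_levelCard (γ : Fin n → ℝ) (A : Matrix (Fin n) (Fin n) ℝ) (a : ℂ) :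
    poleDegree (localFilter γ * transferFunction γ A) (a : OnePoint ℂ) +
        levelCard (fun i => (γ i : ℂ)) a =
      ((Matrix.diagonal γ + A).charpoly.map (algebraMap ℝ ℂ)).rootMultiplicity a +
        levelRank (fun i => (γ i : ℂ)) (A.map (algebraMap ℝ ℂ)) a := by
  classical
  set χ := (Matrix.diagonal γ + A).charpoly with hχ
  have hχ0 : χ ≠ 0 := (Matrix.charpoly_monic _).ne_zero
  have hle := levelRank_le_levelCard (fun i => (γ i : ℂ)) (A.map (algebraMap ℝ ℂ)) a
  set d := levelCard (fun i => (γ i : ℂ)) a -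
    levelRank (fun i => (γ i : ℂ)) (A.map (algebraMap ℝ ℂ)) a with hd
  have hdvd : ∀ (k : ℕ) (r c : Fin k ↪o Fin n),
      (X - C a) ^ d ∣ (minorNum γ A r c).map (algebraMap ℝ ℂ) := by
    intro k r c
    rw [minorNum_map γ A r c.injective]
    exact pow_dvd_minorNum _ _ a r c.injective
  have hmap0 : ∀ {g : ℝ[X]}, g ≠ 0 → g.map (algebraMap ℝ ℂ) ≠ 0 := fun hg =>
    (Polynomial.map_ne_zero_iff (algebraMap ℝ ℂ).injective).mpr hg
  -- The empty minor has numerator `χ`, so `d` cannot exceed the multiplicity in `χ` and no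
  -- subtraction is truncated.
  have hdχ : d ≤ (χ.map (algebraMap ℝ ℂ)).rootMultiplicity a := by
    rw [le_rootMultiplicity_iff (hmap0 hχ0)]
    let r : Fin 0 ↪o Fin n := OrderEmbedding.ofIsEmpty
    have h := hdvd 0 r r
    have he : minorNum γ A r r = χ := by
      rw [hχ, ← det_polyPencil, minorNum]
      congr 1
      refine Matrix.ext fun i j => ?_
      exact replaceRows_apply_of_notMem _ _ (fun ⟨l, _⟩ => l.elim0) j
    rwa [he] at h
  have hmain : poleDegree (localFilter γ * transferFunction γ A) (a : OnePoint ℂ) =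
      (χ.map (algebraMap ℝ ℂ)).rootMultiplicity a - d := by
    apply le_antisymm
    · rw [poleDegree]
      refine Finset.sup_le fun k _ => Finset.sup_le fun r _ => Finset.sup_le fun c _ => ?_
      have hdet := det_submatrix_mul_charpoly γ A r c.injective
      by_cases h0 : minorNum γ A r c = 0
      · rw [h0, map_zero, mul_eq_zero,
          or_iff_left (RatFunc.algebraMap_ne_zero hχ0)] at hdet
        rw [hdet, poleOrder_zero]
        exact Nat.zero_le _
      · rw [poleOrder_coe_of_mul_eq h0 hχ0 hdet]
        exact Nat.sub_le_sub_left ((le_rootMultiplicity_iff (hmap0 h0)).mpr (hdvd k r c)) _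
    · obtain ⟨k, hk, r, c, hne, hmul⟩ := exists_minorNum_rootMultiplicity
        (fun i => (γ i : ℂ)) (A.map (algebraMap ℝ ℂ)) a
      have hmm : (minorNum γ A r c).map (algebraMap ℝ ℂ) =
        minorNum (fun i => (γ i : ℂ)) (A.map (algebraMap ℝ ℂ)) r c :=
          minorNum_map γ A r c.injective _
      have h0 : minorNum γ A r c ≠ 0 := by
        rintro h
        rw [h, Polynomial.map_zero] at hmm
        exact hne hmm.symm
      refine le_trans (le_of_eq ?_) (poleOrder_le_poleDegree _ _ hk hk r c)
      rw [poleOrder_coe_of_mul_eq h0 hχ0 (det_submatrix_mul_charpoly γ A r c.injective), hmm, hmul]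
  omega

theorem not_isMatrixPole_infty (γ : Fin n → ℝ) (A : Matrix (Fin n) (Fin n) ℝ) :
    ¬IsMatrixPole (localFilter γ * transferFunction γ A) OnePoint.infty := by
  rintro ⟨i, j, h⟩
  have hc : Function.Injective (fun _ : Fin 1 => j) := Function.injective_of_subsingleton _
  have hdet := det_submatrix_mul_charpoly γ A (fun _ : Fin 1 => i) hc
  rw [Matrix.det_fin_one, Matrix.submatrix_apply] at hdet
  have h0 := poleOrder_infty_of_mul_eq (Matrix.charpoly_monic _).ne_zero hdet (by
    rw [Matrix.charpoly_natDegree_eq_dim, Fintype.card_fin]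
    exact natDegree_minorNum_le γ A _ hc)
  omega

/-- The complexity is the sum, over the distinct values of `γ`, of the ranks of the blocks of
columns of `A` on which `γ` is constant. -/
theorem complexity_eq_sum_levelRank (γ : Fin n → ℝ) (A : Matrix (Fin n) (Fin n) ℝ) :
    complexity γ A = ∑ a ∈ Finset.univ.image (fun i => (γ i : ℂ)),
      levelRank (fun i => (γ i : ℂ)) (A.map (algebraMap ℝ ℂ)) a := by
  classical
  set G := localFilter γ * transferFunction γ A with hG
  set p := (Matrix.diagonal γ + A).charpoly.map (algebraMap ℝ ℂ) with hp
  have hpdeg : p.natDegree = n := by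
    rw [hp, (Matrix.charpoly_monic _).natDegree_map, Matrix.charpoly_natDegree_eq_dim,
      Fintype.card_fin]
  set V := Finset.univ.image (fun i => (γ i : ℂ)) with hV
  set P := (finite_matrixPoles G).toFinset.preimage (OnePoint.some : ℂ → OnePoint ℂ)
    OnePoint.coe_injective.injOn with hP
  -- A common index set containing the values of `γ`, the finite poles and the roots of `χ`; every
  -- sum below has zero terms outside its own part.
  set T := V ∪ P ∪ p.roots.toFinset with hT
  have h1 : complexity γ A = ∑ a ∈ T, poleDegree G (a : OnePoint ℂ) := by
    have himg : P.image (OnePoint.some : ℂ → OnePoint ℂ) = (finite_matrixPoles G).toFinset := by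
      ext x
      simp only [hP, Finset.mem_image, Finset.mem_preimage, Set.Finite.mem_toFinset,
        Set.mem_ofPred_eq]
      constructor
      · rintro ⟨y, hy, rfl⟩; exact hy
      · intro hx
        cases x with
        | infty => exact absurd hx (not_isMatrixPole_infty γ A)
        | coe y => exact ⟨y, hx, rfl⟩
    rw [complexity, mcMillanDegree, ← hG, ← himg,
      Finset.sum_image OnePoint.coe_injective.injOn]
    refine Finset.sum_subset (fun x hx => by simp [hT, hx]) fun x _ hx => ?_
    apply poleDegree_eq_zero_of_not_isMatrixPole
    simpa [hP] using hx
  have h2 : ∑ a ∈ T, p.rootMultiplicity a = n := by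
    rw [← hpdeg, ← IsAlgClosed.card_roots_eq_natDegree (p := p)]
    simp_rw [← count_roots]
    exact Multiset.sum_count_eq_card fun a ha => by
      simp [hT, Multiset.mem_toFinset.mpr ha]
  have h3 : ∑ a ∈ T, levelCard (fun i => (γ i : ℂ)) a = n := by
    have := Finset.card_eq_sum_card_fiberwise (s := (Finset.univ : Finset (Fin n)))
      (f := fun i => (γ i : ℂ)) (t := T) (fun i _ => by simp [hT, hV])
    rw [Finset.card_univ, Fintype.card_fin] at this
    refine Eq.trans (Finset.sum_congr rfl fun a _ => ?_) this.symm
    rw [levelCard, Nat.card_eq_fintype_card, Fintype.card_subtype]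
  have h4 : ∑ a ∈ V, levelRank (fun i => (γ i : ℂ)) (A.map (algebraMap ℝ ℂ)) a =
      ∑ a ∈ T, levelRank (fun i => (γ i : ℂ)) (A.map (algebraMap ℝ ℂ)) a := by
    refine Finset.sum_subset (fun x hx => by simp [hT, hx]) fun x _ hx => ?_
    rw [← Nat.le_zero]
    refine (levelRank_le_levelCard _ _ _).trans ?_
    rw [Nat.le_zero, levelCard, Nat.card_eq_zero]
    left
    exact ⟨fun i => hx (by rw [hV, ← i.2]; exact Finset.mem_image_of_mem _ (Finset.mem_univ _))⟩
  have h5 := Finset.sum_congr (rfl : T = T) fun a _ => poleDegree_add_levelCard γ A a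
  rw [Finset.sum_add_distrib, Finset.sum_add_distrib, ← hG, ← h1, h3, ← h4, ← hp, h2] at h5
  omega

end PoleDegree

/-! ### Bounds and optimal edge weights -/

section Structural

variable {n : ℕ}

theorem levelRank_le_rank {K : Type*} [Field K] (γ : Fin n → K) (A : Matrix (Fin n) (Fin n) K)
    (t : K) : levelRank γ A t ≤ A.rank := by
  rw [levelRank, Matrix.rank_eq_finrank_span_cols]
  apply Submodule.finrank_mono
  apply Submodule.span_mono
  rintro _ ⟨i, rfl⟩
  exact ⟨i.1, rfl⟩

theorem levelRank_const {K : Type*} [Field K] (A : Matrix (Fin n) (Fin n) K) (t : K) :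
    levelRank (fun _ => t) A t = A.rank := by
  rw [levelRank, Matrix.rank_eq_finrank_span_cols]
  have h : (Set.range fun i : {_i : Fin n // t = t} => A.col i) = Set.range A.col := by
    ext x
    exact ⟨fun ⟨i, hi⟩ => ⟨i.1, hi⟩, fun ⟨i, hi⟩ => ⟨⟨i, rfl⟩, hi⟩⟩
  rw [h]

theorem finrank_finset_sup_le {K V ι : Type*} [Field K] [AddCommGroup V] [Module K V]
    [FiniteDimensional K V] (s : Finset ι) (W : ι → Submodule K V) :
    Module.finrank K (s.sup W : Submodule K V) ≤ ∑ i ∈ s, Module.finrank K (W i) := by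
  classical
  induction s using Finset.induction_on with
  | empty => simp
  | insert a s ha ih =>
    rw [Finset.sup_insert, Finset.sum_insert ha]
    exact (Submodule.finrank_add_le_finrank_add_finrank _ _).trans (Nat.add_le_add_left ih _)

open scoped Classical in
theorem rank_le_sum_levelRank {K : Type*} [Field K] (γ : Fin n → K)
    (A : Matrix (Fin n) (Fin n) K) :
    A.rank ≤ ∑ t ∈ Finset.univ.image γ, levelRank γ A t := by
  rw [Matrix.rank_eq_finrank_span_cols]
  refine le_trans (Submodule.finrank_mono ?_) (finrank_finset_sup_le _ _)
  rw [Submodule.span_le]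
  rintro _ ⟨i, rfl⟩
  exact Finset.le_sup (f := fun t =>
    Submodule.span K (Set.range fun i : {i // γ i = t} => A.col i))
    (Finset.mem_image_of_mem γ (Finset.mem_univ i)) (Submodule.subset_span ⟨⟨i, rfl⟩, rfl⟩)

theorem networkMatrix_map_apply (G : Digraph (Fin n)) (a : Fin n → Fin n → ℝ) (i j : Fin n)
    [Decidable (G.Adj j i)] :
    (networkMatrix G a).map (algebraMap ℝ ℂ) i j = if G.Adj j i then (a i j : ℂ) else 0 := by
  rw [networkMatrix, Matrix.map_apply, Matrix.of_apply]
  by_cases h : G.Adj j i <;> simp [h]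

theorem mem_sinks_iff {G : Digraph (Fin n)} {v : Fin n} : v ∈ sinks G ↔ ∀ w, ¬G.Adj v w := by
  classical
  rw [sinks, Finset.mem_filter, outDegree, Finset.card_eq_zero, Finset.filter_eq_empty_iff]
  simp

open scoped Classical in
theorem levelRank_networkMatrix_le (γ : Fin n → ℂ) (G : Digraph (Fin n))
    (a : Fin n → Fin n → ℝ) (t : ℂ) :
    levelRank γ ((networkMatrix G a).map (algebraMap ℝ ℂ)) t ≤
      ((sinks G)ᶜ.filter fun i => γ i = t).card := by
  set A := (networkMatrix G a).map (algebraMap ℝ ℂ) with hA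
  set s := (sinks G)ᶜ.filter fun i => γ i = t with hs
  have h : Submodule.span ℂ (Set.range fun i : {i // γ i = t} => A.col i) ≤
      Submodule.span ℂ (s.image A.col : Set (Fin n → ℂ)) := by
    rw [Submodule.span_le]
    rintro _ ⟨⟨i, hi⟩, rfl⟩
    by_cases hsi : i ∈ sinks G
    · have hz : A.col i = 0 := by
        ext x
        change A x i = 0
        rw [hA, networkMatrix_map_apply, if_neg (mem_sinks_iff.mp hsi x)]
      change A.col i ∈ _
      rw [hz]
      exact Submodule.zero_mem _
    · exact Submodule.subset_span (Finset.mem_coe.mpr (Finset.mem_image_of_mem _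
        (by rw [hs, Finset.mem_filter, Finset.mem_compl]; exact ⟨hsi, hi⟩)))
  exact (Submodule.finrank_mono h).trans
    ((finrank_span_finset_le_card _).trans Finset.card_image_le)

theorem complexity_le (γ : Fin n → ℝ) (G : Digraph (Fin n)) (a : Fin n → Fin n → ℝ) :
    complexity γ (networkMatrix G a) ≤ (sinks G)ᶜ.card := by
  classical
  rw [complexity_eq_sum_levelRank, Finset.card_eq_sum_card_fiberwise (s := (sinks G)ᶜ)
    (f := fun i => (γ i : ℂ)) (t := Finset.univ.image fun i => (γ i : ℂ)) (fun i _ => by simp)]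
  convert Finset.sum_le_sum fun t _ => levelRank_networkMatrix_le (fun i => (γ i : ℂ)) G a t

/-- A nonsingular block whose size is the rank has a nonzero term in its Leibniz expansion; the
entries of that term are edges with distinct start nodes and distinct end nodes. -/
theorem rank_le_matchingNumber (G : Digraph (Fin n)) (a : Fin n → Fin n → ℝ) :
    ((networkMatrix G a).map (algebraMap ℝ ℂ)).rank ≤ matchingNumber G := by
  classical
  set A := (networkMatrix G a).map (algebraMap ℝ ℂ) with hA
  obtain ⟨I, J, hIJ, hJ, -, hv⟩ := exists_nonsingular_block (fun _ => (0 : ℂ)) A 0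
  rw [levelRank_const] at hJ
  let e : J ≃ I := Finset.equivOfCardEq hIJ.symm
  let B : Matrix J J ℂ := Matrix.of fun i j => A (e i) j
  have hB : B.det ≠ 0 := by
    intro h0
    obtain ⟨v, hv0, hBv⟩ := Matrix.exists_mulVec_eq_zero_iff.mpr h0
    apply hv0
    have hext := hv (Function.extend Subtype.val v 0)
      (fun j hj => Function.extend_apply' _ _ _ (by rintro ⟨x, rfl⟩; exact hj x.2)) (by
        intro i hi
        have h1 := congrFun hBv (e.symm ⟨i, hi⟩)
        rw [Pi.zero_apply] at h1
        rw [← h1, Matrix.mulVec, Matrix.mulVec, dotProduct, dotProduct]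
        refine (Fintype.sum_of_injective Subtype.val Subtype.val_injective _ _ ?_ ?_).symm
        · intro j hj
          rw [Function.extend_apply' _ _ _ hj, Pi.zero_apply, mul_zero]
        · intro j
          rw [Subtype.val_injective.extend_apply]
          simp [B])
    ext j
    have h2 := congrFun hext j
    rwa [Subtype.val_injective.extend_apply] at h2
  rw [Matrix.det_apply] at hB
  obtain ⟨σ, -, hσ⟩ := Finset.exists_ne_zero_of_sum_ne_zero hB
  have hσ' : ∀ j : J, A (e (σ j)) j ≠ 0 := by
    intro j hj
    apply hσ
    rw [Finset.prod_eq_zero (Finset.mem_univ j) hj, smul_zero]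
  let f : J ↪ Fin n × Fin n := ⟨fun j => (j.1, (e (σ j)).1), fun x y h =>
    Subtype.ext (congrArg Prod.fst h)⟩
  have hM : IsDiMatching G (Finset.univ.map f) := by
    refine ⟨?_, ?_⟩
    · intro x hx
      obtain ⟨j, -, rfl⟩ := Finset.mem_map.mp hx
      by_contra hadj
      apply hσ' j
      rw [hA, networkMatrix_map_apply]
      exact if_neg hadj
    · intro x hx y hy hxy
      obtain ⟨j, -, rfl⟩ := Finset.mem_map.mp hx
      obtain ⟨j', -, rfl⟩ := Finset.mem_map.mp hy
      refine ⟨fun h => hxy (congrArg f (Subtype.ext h)), fun h => hxy (congrArg f ?_)⟩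
      exact σ.injective (e.injective (Subtype.ext h))
  rw [← hJ, matchingNumber]
  refine le_trans (le_of_eq ?_) (Finset.le_sup (f := Finset.card)
    (Finset.mem_filter.mpr ⟨Finset.mem_univ _, hM⟩))
  simp

theorem complexity_le_matchingNumber {γ : Fin n → ℝ} (hγ : ∀ i j, γ i = γ j)
    (G : Digraph (Fin n)) (a : Fin n → Fin n → ℝ) :
    complexity γ (networkMatrix G a) ≤ matchingNumber G := by
  classical
  rw [complexity_eq_sum_levelRank]
  have hcard : (Finset.univ.image fun i => (γ i : ℂ)).card ≤ 1 := by
    -- At most one level, and none when `n = 0`.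
    rw [Finset.card_le_one]
    simp only [Finset.mem_image, Finset.mem_univ, true_and]
    rintro _ ⟨i, rfl⟩ _ ⟨j, rfl⟩
    rw [hγ i j]
  refine (Finset.sum_le_card_nsmul _ _ (matchingNumber G) fun t _ =>
    (levelRank_le_rank _ _ _).trans (rank_le_matchingNumber G a)).trans ?_
  rw [smul_eq_mul]
  refine (Nat.mul_le_mul_right _ ?_).trans (one_mul _).le
  convert hcard

/-- Put weight `1` on a maximum matching and `0` elsewhere: the columns of its start nodes are
distinct standard basis vectors. -/
theorem exists_matchingNumber_le_complexity (γ : Fin n → ℝ) (G : Digraph (Fin n)) :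
    ∃ a : Fin n → Fin n → ℝ, matchingNumber G ≤ complexity γ (networkMatrix G a) := by
  classical
  obtain ⟨M, hM, hcard⟩ := Finset.exists_mem_eq_sup
    (Finset.univ.filter fun M : Finset (Fin n × Fin n) => IsDiMatching G M)
    ⟨∅, by simp [IsDiMatching]⟩ Finset.card
  have hM' : IsDiMatching G M := (Finset.mem_filter.mp hM).2
  refine ⟨fun i j => if (j, i) ∈ M then 1 else 0, ?_⟩
  set A := (networkMatrix G fun i j => if (j, i) ∈ M then 1 else 0).map (algebraMap ℝ ℂ) with hA
  have hcol : ∀ e : M, A.col e.1.1 = Pi.basisFun ℂ (Fin n) e.1.2 := by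
    rintro ⟨⟨j, i⟩, he⟩
    ext x
    change A x j = _
    rw [hA, networkMatrix_map_apply, Pi.basisFun_apply]
    dsimp only
    by_cases hx : x = i
    · subst hx
      have hadj : G.Adj j x := hM'.1 _ he
      simp [hadj, he]
    · have hn : (j, x) ∉ M := fun h =>
        (hM'.2 _ h _ he (by simp [hx])).1 rfl
      simp [hn, hx]
  have hinj : Function.Injective fun e : M => e.1.2 := by
    intro e e' h
    by_contra hne
    exact (hM'.2 _ e.2 _ e'.2 fun h' => hne (Subtype.ext h')).2 h
  have hli : LinearIndependent ℂ fun e : M => A.col e.1.1 := by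
    simp_rw [hcol]
    exact (Pi.basisFun ℂ (Fin n)).linearIndependent.comp _ hinj
  have hrank : M.card ≤ A.rank := by
    rw [Matrix.rank_eq_finrank_span_cols, ← Fintype.card_coe M, ← finrank_span_eq_card hli]
    apply Submodule.finrank_mono
    apply Submodule.span_mono
    rintro _ ⟨e, rfl⟩
    exact ⟨_, rfl⟩
  rw [complexity_eq_sum_levelRank, ← hA]
  refine le_trans (le_trans (le_of_eq ?_) hrank)
    (le_trans (rank_le_sum_levelRank (fun i => (γ i : ℂ)) A) (le_of_eq ?_))
  · rw [matchingNumber, ← hcard]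
  · congr!

/-- With all weights `1`, each level is one column, and the column of a non-sink is nonzero, so it
contributes rank at least `1`. -/
theorem exists_card_compl_sinks_le_complexity {γ : Fin n → ℝ} (hγ : Function.Injective γ)
    (G : Digraph (Fin n)) :
    ∃ a : Fin n → Fin n → ℝ, (sinks G)ᶜ.card ≤ complexity γ (networkMatrix G a) := by
  classical
  refine ⟨fun _ _ => 1, ?_⟩
  rw [complexity_eq_sum_levelRank,
    Finset.sum_image fun i _ j _ h => hγ (Complex.ofReal_injective h), Finset.card_eq_sum_ones]
  refine le_trans (Finset.sum_le_sum fun i hi => ?_)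
    (Finset.sum_le_sum_of_subset (Finset.subset_univ _))
  rw [Finset.mem_compl, mem_sinks_iff] at hi
  push Not at hi
  obtain ⟨w, hw⟩ := hi
  rw [Nat.succ_le_iff, levelRank, Module.finrank_pos_iff, Submodule.nontrivial_iff_ne_bot]
  intro hbot
  have hmem := Submodule.subset_span (R := ℂ) (Set.mem_range_self
    (f := fun x : {x // (γ x : ℂ) = (γ i : ℂ)} =>
      ((networkMatrix G fun _ _ => 1).map (algebraMap ℝ ℂ)).col x) ⟨i, rfl⟩)
  rw [hbot] at hmem
  have h0 : ((networkMatrix G fun _ _ => 1).map (algebraMap ℝ ℂ)) w i = 0 := congrFun hmem w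
  rw [networkMatrix_map_apply, if_pos hw] at h0
  simp at h0

end Structural

/-- The first conjunct says that the maximum defining the structural complexity exists. -/
theorem mainTheorem3 (n : ℕ) (γ : Fin n → ℝ) (G : Digraph (Fin n)) :
    IsGreatest (complexityValues γ G) (structuralComplexity γ G) ∧
    matchingNumber G ≤ structuralComplexity γ G ∧
    (structuralComplexity γ G : ℤ) ≤ (n : ℤ) - ((sinks G).card : ℤ) ∧
    ((∀ i j, γ i = γ j) → structuralComplexity γ G = matchingNumber G) ∧
    (Function.Injective γ →
      (structuralComplexity γ G : ℤ) = (n : ℤ) - ((sinks G).card : ℤ)) := by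
  have hbdd : BddAbove (complexityValues γ G) :=
    ⟨_, by rintro _ ⟨a, rfl⟩; exact complexity_le γ G a⟩
  have hmem : structuralComplexity γ G ∈ complexityValues γ G :=
    Nat.sSup_mem (Set.range_nonempty _) hbdd
  have hle : ∀ a, complexity γ (networkMatrix G a) ≤ structuralComplexity γ G := fun a =>
    le_csSup hbdd ⟨a, rfl⟩
  have hcard : (sinks G)ᶜ.card + (sinks G).card = n := by
    rw [Finset.card_compl_add_card, Fintype.card_fin]
  obtain ⟨a, ha⟩ := hmem
  have hν : matchingNumber G ≤ structuralComplexity γ G := by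
    obtain ⟨b, hb⟩ := exists_matchingNumber_le_complexity γ G
    exact hb.trans (hle b)
  have hub : structuralComplexity γ G ≤ (sinks G)ᶜ.card := ha ▸ complexity_le γ G a
  refine ⟨⟨⟨a, ha⟩, fun _ hx => le_csSup hbdd hx⟩, hν, by omega, fun hγ => ?_, fun hγ => ?_⟩
  · exact le_antisymm (ha ▸ complexity_le_matchingNumber hγ G a) hν
  · obtain ⟨b, hb⟩ := exists_card_compl_sinks_le_complexity hγ G
    have := hb.trans (hle b)
    omega
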